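/- Let $p$ be a prime, let $dx$ be the Haar measure on $\mathbb{Q}_p$ normalized so that $B_0(0)=\{x:|x|_p\le 1\}$ has measure $1$, and let $I_p=\{p^{-\gamma}(a_0+a_1p+\cdots+a_{\gamma-1}p^{\gamma-1}):\gamma\in\mathbb{N},\ a_j\in\{0,\dots,p-1\}\}$. A multiresolution analysis (MRA) is a family of closed subspaces $V_j\subset L_2(\mathbb{Q}_p)$, $j\in\mathbb{Z}$, such that $V_j\subset V_{j+1}$, $\bigcup_j V_j$ is dense, $\bigcap_j V_j=\{0\}$, $f\in V_j\Leftrightarrow f(p^{-1}\cdot)\in V_{j+1}$, and there is a $\phi\in V_0$ (a scaling function, which is said to generate the MRA) such that $\{\phi(\cdot-a):a\in I_p\}$ is an orthonormal basis of $V_0$. For a compactly supported $\phi$ let $S(\phi)$ be the space of all functions $\sum_{\alpha\in I_p}b(\alpha)\,\phi(\cdot-\alpha)$ with $b:I_p\to\mathbb{C}$ arbitrary (functions equal almost everywhere being identified). For an integer $k\ge 0$, $\phi$ has accuracy $k$ if $S(\phi)$ contains all polynomials of degree less than $k$; here a polynomial $r$ has coefficients in $\mathbb{Q}_p$, and is regarded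 as the complex-valued function $\iota\circ r$ through a field embedding $\iota:\mathbb{Q}_p\to\mathbb{C}$. **Theorem.** Let $\phi\in L_2(\mathbb{Q}_p)$ be a scaling function that generates an MRA, with $\operatorname{supp}\phi\subset B_0(0)$. Then there is exactly one refinement mask of $\phi$, that is, exactly one sequence $h:I_p\to\mathbb{C}$ vanishing off $\{k/p:0\le k\le p-1\}$ with $\sum_{k=0}^{p-1}h(k/p)=p$ and $$\phi(x)=\sum_{k=0}^{p-1}h\!\left(\tfrac{k}{p}\right)\phi\!\left(\tfrac{x}{p}-\tfrac{k}{p}\right)\quad\text{for almost every }x\in\mathbb{Q}_p,$$ and it is the Haar mask: $h(k/p)=1$ for all $k=0,1,\dots,p-1$. Moreover, $\phi$ has accuracy exactly $1$: for every field embedding $\iota:\mathbb{Q}_p\to\mathbb{C}$ and every integer $k\ge 0$, $\phi$ has accuracy $k$ if and only if $k\le 1$. -/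

import Mathlib

open MeasureTheory
open scoped ENNReal

namespace PadicMRA

noncomputable section

variable (p : ℕ) [Fact p.Prime]

instance instMeasurableSpacePadic : MeasurableSpace ℚ_[p] := borel ℚ_[p]

instance instBorelSpacePadic : BorelSpace ℚ_[p] := ⟨rfl⟩

/-- The disc `B_0(0) = {x : |x|_p ≤ 1}`, as a compact set with nonempty interior. -/
def unitDisc : TopologicalSpace.PositiveCompacts ℚ_[p] where
  carrier := Metric.closedBall 0 1
  isCompact' := isCompact_closedBall 0 1
  interior_nonempty' :=
    ⟨0, Metric.ball_subset_interior_closedBall (Metric.mem_ball_self one_pos)⟩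

/-- The Haar measure on `ℚ_p`, normalized to give the disc `B_0(0)` measure `1`. -/
def haar : Measure ℚ_[p] := Measure.addHaarMeasure (unitDisc p)

instance instIsAddHaarMeasureHaar : (haar p).IsAddHaarMeasure :=
  inferInstanceAs (Measure.addHaarMeasure (unitDisc p)).IsAddHaarMeasure

/-- The complex Hilbert space `L_2(ℚ_p)`. -/
abbrev L2 : Type := Lp ℂ 2 (haar p)

/-- The set `I_p` of shifts: all `p^{-γ} (a_0 + a_1 p + ⋯ + a_{γ-1} p^{γ-1})` with `γ ∈ ℕ` and
digits `a_j ∈ {0, …, p-1}`. -/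
def shiftSet : Set ℚ_[p] :=
  {a | ∃ (γ : ℕ) (d : Fin γ → Fin p),
    a = ((p : ℚ_[p]) ^ γ)⁻¹ * ∑ i : Fin γ, ((d i : ℕ) : ℚ_[p]) * (p : ℚ_[p]) ^ (i : ℕ)}

theorem div_mem_shiftSet (M : ℕ) (k : Fin (p ^ M)) :
    ((k : ℕ) : ℚ_[p]) / (p : ℚ_[p]) ^ M ∈ shiftSet p := by
  refine ⟨M, finFunctionFinEquiv.symm k, ?_⟩
  have h : ((k : ℕ) : ℚ_[p])
      = ∑ i : Fin M, ((finFunctionFinEquiv.symm k i : ℕ) : ℚ_[p]) * (p : ℚ_[p]) ^ (i : ℕ) := by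
    have h0 := congrArg (fun t : Fin (p ^ M) => ((t : ℕ) : ℚ_[p]))
      (finFunctionFinEquiv.apply_symm_apply k)
    simp only [finFunctionFinEquiv_apply] at h0
    rw [← h0]
    push_cast
    rfl
  rw [← h, div_eq_mul_inv, mul_comm]

variable {p}

/-- The element `k / p^M` of `I_p`, for `0 ≤ k < p^M`. -/
def node (M : ℕ) (k : Fin (p ^ M)) : shiftSet p :=
  ⟨((k : ℕ) : ℚ_[p]) / (p : ℚ_[p]) ^ M, div_mem_shiftSet p M k⟩

/-- The translate `φ(· - a)` of `φ ∈ L_2(ℚ_p)`. -/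
def translate (a : ℚ_[p]) (φ : L2 p) : L2 p :=
  Lp.compMeasurePreserving (fun x => x - a) (measurePreserving_sub_right (haar p) a) φ

/-- `φ` is a scaling function for the family `V`: it lies in `V_0`, and its translates
`φ(· - a)`, `a ∈ I_p`, form an orthonormal basis of `V_0`. -/
structure IsScalingFunction (V : ℤ → Submodule ℂ (L2 p)) (φ : L2 p) : Prop where
  mem : φ ∈ V 0
  orthonormal : Orthonormal ℂ (fun a : shiftSet p => translate (a : ℚ_[p]) φ)
  closure_span : (Submodule.span ℂ
    (Set.range fun a : shiftSet p => translate (a : ℚ_[p]) φ)).topologicalClosure = V 0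

/-- A multiresolution analysis in `L_2(ℚ_p)`, with the dilation `A x = p⁻¹ x`. -/
structure IsMRA (V : ℤ → Submodule ℂ (L2 p)) : Prop where
  isClosed : ∀ j, IsClosed (V j : Set (L2 p))
  mono : ∀ j, V j ≤ V (j + 1)
  dense : Dense (⋃ j, (V j : Set (L2 p)))
  inter : (⋂ j, (V j : Set (L2 p))) = {0}
  dilation : ∀ (j : ℤ) (f g : L2 p),
    (g : ℚ_[p] → ℂ) =ᵐ[haar p] (fun x => f ((p : ℚ_[p])⁻¹ * x)) → (f ∈ V j ↔ g ∈ V (j + 1))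
  exists_scaling : ∃ φ, IsScalingFunction V φ

/-- `φ` is a scaling function that generates an MRA. -/
def GeneratesMRA (φ : L2 p) : Prop :=
  ∃ V : ℤ → Submodule ℂ (L2 p), IsMRA V ∧ IsScalingFunction V φ

/-- `supp φ ⊆ B_N(0)`, for the support of an element of `L_2` (the complement of the largest open
set on which it vanishes almost everywhere). -/
def SupportedIn (N : ℕ) (φ : L2 p) : Prop :=
  ∀ᵐ x ∂haar p, x ∉ Metric.closedBall (0 : ℚ_[p]) ((p : ℝ) ^ N) → φ x = 0

/-- The sequence `h` on `I_p` is a refinement mask of `φ` (for a `φ` supported in `B_N(0)`):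
it vanishes off the points `k / p^{N+1}`, `0 ≤ k < p^{N+1}`, its values there sum to `p`, and
`φ(x) = ∑_k h(k / p^{N+1}) φ(x / p - k / p^{N+1})` as elements of `L_2`. -/
structure IsRefinementMask (N : ℕ) (φ : L2 p) (h : shiftSet p → ℂ) : Prop where
  eq_zero : ∀ a, a ∉ Set.range (node (p := p) (N + 1)) → h a = 0
  sum_eq : ∑ k : Fin (p ^ (N + 1)), h (node (N + 1) k) = p
  refinement : (φ : ℚ_[p] → ℂ) =ᵐ[haar p] fun x => ∑ k : Fin (p ^ (N + 1)),
    h (node (N + 1) k) * φ (x / (p : ℚ_[p]) - (node (N + 1) k : ℚ_[p]))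

/-- The semi-convolution `φ *' b (x) = ∑_{α ∈ I_p} φ(x - α) b(α)` of a compactly supported `φ`
with a sequence `b` on `I_p`: at almost every `x` only finitely many terms are nonzero. -/
def semiconv (φ : L2 p) (b : shiftSet p → ℂ) (x : ℚ_[p]) : ℂ :=
  ∑' α : shiftSet p, φ (x - α) * b α

/-- The shift-invariant space `S(φ) = {φ *' b : b ∈ l(I_p)}`; functions that agree almost
everywhere are identified. -/
def shiftInvariantSpace (φ : L2 p) : Set (ℚ_[p] → ℂ) :=
  {f | ∃ b : shiftSet p → ℂ, f =ᵐ[haar p] semiconv φ b}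

/-- Field embeddings `ℚ_p → ℂ` exist, so that statements about all of them are not vacuous. -/
theorem nonempty_ringHom_complex (p : ℕ) [Fact p.Prime] : Nonempty (ℚ_[p] →+* ℂ) := by
  have h1 : Cardinal.mk ℚ_[p] ≤ Cardinal.continuum := by
    calc Cardinal.mk ℚ_[p] ≤ Cardinal.mk (CauSeq ℚ (padicNorm p)) := Cardinal.mk_quotient_le
      _ ≤ Cardinal.mk (ℕ → ℚ) := Cardinal.mk_subtype_le _
      _ = Cardinal.continuum := by simp
  have h2 : Cardinal.continuum ≤ Cardinal.mk ℚ_[p] := continuum_le_cardinal_of_nontriviallyNormedField _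
  have h3 : Cardinal.mk (AlgebraicClosure ℚ_[p]) = Cardinal.continuum := by
    apply le_antisymm
    · refine (Algebra.IsAlgebraic.cardinalMk_le_max ℚ_[p] _).trans ?_
      simp [h1]
    · exact h2.trans (Cardinal.mk_le_of_injective (algebraMap ℚ_[p] (AlgebraicClosure ℚ_[p])).injective)
  have : CharZero (AlgebraicClosure ℚ_[p]) :=
    charZero_of_injective_algebraMap (algebraMap ℚ_[p] (AlgebraicClosure ℚ_[p])).injective
  obtain ⟨e⟩ := IsAlgClosed.ringEquiv_of_equiv_of_charZero (K := AlgebraicClosure ℚ_[p]) (L := ℂ)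
    (by rw [h3]; exact Cardinal.aleph0_lt_continuum) (Cardinal.eq.1 (by rw [h3, Cardinal.mk_complex]))
  exact ⟨(e : AlgebraicClosure ℚ_[p] →+* ℂ).comp (algebraMap _ _)⟩

/-- `φ` has accuracy `k` if `S(φ)` contains all polynomials of degree less than `k`. Polynomials
on `ℚ_p` have coefficients in `ℚ_p` while the members of `S(φ)` are complex-valued; values are
compared through a field embedding `ι : ℚ_p → ℂ`. -/
def HasAccuracy (ι : ℚ_[p] →+* ℂ) (φ : L2 p) (k : ℕ) : Prop :=
  (Submodule.span ℂ {f : ℚ_[p] → ℂ | ∃ r : Polynomial ℚ_[p],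
    r.degree < k ∧ f = fun x => ι (r.eval x)} : Set (ℚ_[p] → ℂ)) ⊆ shiftInvariantSpace φ

end

end PadicMRA

namespace PadicMRA

noncomputable section

variable {p : ℕ} [Fact p.Prime]

/-! The discs of radius `1` about the points of `I_p` tile `ℚ_p`, and `p⁻¹ℤ_p` is the union of those
about `k/p`. As `φ(p ·)` lies in `V 0` and lives on `p⁻¹ℤ_p`, its expansion in translates of `φ`
involves only the shifts `k/p`, which gives a refinement equation (`exists_dilate_eq_sum`).

Parseval gives `∑ |h|² = p`; integration gives `∑ h = p` once `∫ φ ≠ 0`. With `p` coefficients, `∑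
|h - 1|² = p - 2p + p = 0`, so the mask is Haar.

The analytic core is `ae_eq_zero_of_refinement`: an integrable solution on the unit disc with zero
integral vanishes. It yields `∫ φ ≠ 0` and, applied to `φ` minus a multiple of the disc's indicator,
shows that `φ` is such a multiple. Hence `S(φ)` consists of the functions a.e. constant on each disc
of the tiling: it contains the constants but not `X`. -/

/-! ### The shifts as representatives of `ℚ_p / ℤ_p` -/

theorem shiftSet_eq_range :
    shiftSet p = Set.range fun q : (M : ℕ) × Fin (p ^ M) => (node q.1 q.2 : ℚ_[p]) := by
  ext a
  constructor
  · rintro ⟨γ, d, rfl⟩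
    refine ⟨⟨γ, finFunctionFinEquiv d⟩, ?_⟩
    simp only [node, finFunctionFinEquiv_apply]
    push_cast
    rw [div_eq_inv_mul]
  · rintro ⟨q, rfl⟩
    exact (node q.1 q.2).2

theorem exists_node_eq (a : shiftSet p) : ∃ (M : ℕ) (k : Fin (p ^ M)), node M k = a := by
  obtain ⟨q, hq⟩ := shiftSet_eq_range.subset a.2
  exact ⟨q.1, q.2, Subtype.ext hq⟩

instance : Countable (shiftSet p) := by
  have : (shiftSet p).Countable := by
    rw [shiftSet_eq_range]
    exact Set.countable_range _
  exact this.to_subtype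

theorem p_ne_zero : (p : ℚ_[p]) ≠ 0 := Nat.cast_ne_zero.2 (Fact.out : p.Prime).ne_zero

theorem p_real_pos : (0 : ℝ) < p := Nat.cast_pos.2 (Fact.out : p.Prime).pos

theorem norm_sub_le_max' (x y : ℚ_[p]) : ‖x - y‖ ≤ max ‖x‖ ‖y‖ := by
  simpa [sub_eq_add_neg] using IsUltrametricDist.norm_add_le_max x (-y)

/-- Distinct elements of `I_p` are at distance greater than `1`. -/
theorem shiftSet_eq_of_norm_sub_le {a b : shiftSet p} (h : ‖(a : ℚ_[p]) - b‖ ≤ 1) : a = b := by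
  obtain ⟨M, k, rfl⟩ := exists_node_eq a
  obtain ⟨N, l, rfl⟩ := exists_node_eq b
  have hp : p.Prime := Fact.out
  have h0 := p_ne_zero (p := p)
  have key : ((((k : ℕ) * p ^ N : ℕ) : ℤ) - ((l : ℕ) * p ^ M : ℕ) : ℚ_[p])
      = (p : ℚ_[p]) ^ (M + N) * ((node M k : ℚ_[p]) - node N l) := by
    simp only [node]
    push_cast
    field_simp
    ring
  -- With denominators cleared, closeness says that two integers in `[0, p^(M+N))` are congruent
  -- modulo `p^(M+N)`, so they coincide.
  have hnorm : ‖(((((k : ℕ) * p ^ N : ℕ) : ℤ) - (((l : ℕ) * p ^ M : ℕ) : ℤ) : ℤ) : ℚ_[p])‖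
      ≤ (p : ℝ) ^ (-((M + N : ℕ) : ℤ)) := by
    rw [zpow_neg, zpow_natCast]
    push_cast at key ⊢
    rw [key, norm_mul, norm_pow, Padic.norm_p, inv_pow]
    exact mul_le_of_le_one_right (by positivity) h
  rw [Padic.norm_int_le_pow_iff_dvd] at hnorm
  have hlt1 : (k : ℕ) * p ^ N < p ^ (M + N) := by
    rw [pow_add]
    exact Nat.mul_lt_mul_of_pos_right k.2 (pow_pos hp.pos _)
  have hlt2 : (l : ℕ) * p ^ M < p ^ (M + N) := by
    rw [pow_add, mul_comm (p ^ M)]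
    exact Nat.mul_lt_mul_of_pos_right l.2 (pow_pos hp.pos _)
  have heq : (k : ℕ) * p ^ N = (l : ℕ) * p ^ M := by
    have := (Nat.modEq_iff_dvd (a := (l : ℕ) * p ^ M) (b := (k : ℕ) * p ^ N)
      (n := p ^ (M + N))).2 (by exact_mod_cast hnorm)
    exact (Nat.ModEq.eq_of_lt_of_lt this hlt2 hlt1).symm
  apply Subtype.ext
  simp only [node]
  rw [div_eq_div_iff (pow_ne_zero _ h0) (pow_ne_zero _ h0)]
  exact_mod_cast heq

/-- A `p`-adic number `x` with `|x| ≤ p ^ M` lies within distance `1` of some `k / p ^ M`. -/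
theorem exists_node_norm_sub_le {M : ℕ} {x : ℚ_[p]} (hx : ‖(p : ℚ_[p]) ^ M * x‖ ≤ 1) :
    ∃ k : Fin (p ^ M), ‖x - node M k‖ ≤ 1 := by
  let y : ℤ_[p] := ⟨(p : ℚ_[p]) ^ M * x, hx⟩
  have h0 := pow_ne_zero M (p_ne_zero (p := p))
  -- The numerator is the residue of `p^M x` modulo `p^M`.
  refine ⟨⟨y.appr M, y.appr_lt M⟩, ?_⟩
  obtain ⟨z, hz⟩ := Ideal.mem_span_singleton.1 (PadicInt.appr_spec M y)
  have hz' : (p : ℚ_[p]) ^ M * x - (y.appr M : ℚ_[p]) = (p : ℚ_[p]) ^ M * z := by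
    have := congrArg (fun t : ℤ_[p] => (t : ℚ_[p])) hz
    rw [PadicInt.coe_sub] at this
    simpa [y] using this
  have : x - node M ⟨y.appr M, y.appr_lt M⟩ = z := by
    simp only [node]
    field_simp
    rw [mul_comm x, hz', mul_comm]
  rw [this]
  exact z.2

theorem exists_shiftSet_norm_sub_le (x : ℚ_[p]) : ∃ a : shiftSet p, ‖x - a‖ ≤ 1 := by
  obtain ⟨M, hM⟩ : ∃ M : ℕ, ‖x‖ ≤ (p : ℝ) ^ M :=
    ⟨_, (pow_unbounded_of_one_lt ‖x‖
      (by exact_mod_cast (Fact.out : p.Prime).one_lt)).choose_spec.le⟩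
  obtain ⟨k, hk⟩ := exists_node_norm_sub_le (M := M) (x := x) (by
    rw [norm_mul, norm_pow, Padic.norm_p, inv_pow]
    exact inv_mul_le_one_of_le₀ hM (by positivity))
  exact ⟨_, hk⟩

theorem node_injective (M : ℕ) : Function.Injective (node (p := p) M) := by
  intro k l h
  have := congrArg (fun t : shiftSet p => (t : ℚ_[p])) h
  simp only [node] at this
  rw [div_left_inj' (pow_ne_zero _ p_ne_zero)] at this
  exact Fin.ext (by exact_mod_cast this)

/-- The exponent `0 + 1` is the form that `N + 1` in `IsRefinementMask` takes at `N = 0`. -/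
theorem norm_p_mul_node_le (k : Fin (p ^ (0 + 1))) : ‖(p : ℚ_[p]) * node (0 + 1) k‖ ≤ 1 := by
  have : (p : ℚ_[p]) * node (0 + 1) k = ((k : ℕ) : ℚ_[p]) := by
    simp only [node, zero_add, pow_one]
    exact mul_div_cancel₀ _ p_ne_zero
  rw [this]
  exact_mod_cast Padic.norm_int_le_one (p := p) ((k : ℕ) : ℤ)

/-- `p ℤ_p`-refinement of the unit disc, for indicator functions. -/
theorem indicator_p_mul (c : ℂ) (x : ℚ_[p]) :
    (Metric.closedBall (0 : ℚ_[p]) 1).indicator (fun _ => c) (p * x) =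
      ∑ k : Fin (p ^ (0 + 1)),
        (Metric.closedBall (0 : ℚ_[p]) 1).indicator (fun _ => c) (x - node (0 + 1) k) := by
  classical
  by_cases hx : ‖(p : ℚ_[p]) * x‖ ≤ 1
  · obtain ⟨k, hk⟩ := exists_node_norm_sub_le (M := 0 + 1) (x := x) (by simpa using hx)
    rw [Finset.sum_eq_single k]
    · rw [Set.indicator_of_mem (by simpa using hx), Set.indicator_of_mem (by simpa using hk)]
    · intro l _ hl
      refine Set.indicator_of_notMem (fun hmem => hl (node_injective _ ?_)) _
      apply shiftSet_eq_of_norm_sub_le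
      have e : (node (0 + 1) l : ℚ_[p]) - node (0 + 1) k
          = (x - node (0 + 1) k) - (x - node (0 + 1) l) := by ring
      rw [e]
      exact (norm_sub_le_max' _ _).trans (max_le hk (by simpa using hmem))
    · simp
  · rw [Set.indicator_of_notMem (by simpa using hx), Finset.sum_eq_zero]
    intro k _
    refine Set.indicator_of_notMem (fun hmem => hx ?_) _
    have e : (p : ℚ_[p]) * x = p * (x - node (0 + 1) k) + p * node (0 + 1) k := by ring
    rw [e]
    refine (IsUltrametricDist.norm_add_le_max _ _).trans (max_le ?_ (norm_p_mul_node_le k))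
    rw [norm_mul]
    exact mul_le_one₀ (Padic.norm_p_lt_one.le) (norm_nonneg _) (by simpa using hmem)

/-! ### Haar measure under dilation -/

theorem haar_closedBall_zero_one : haar p (Metric.closedBall 0 1) = 1 :=
  Measure.addHaarMeasure_self (K₀ := unitDisc p)

/-- Dilation by `p` scales the Haar measure. -/
theorem map_p_mul_haar :
    (haar p).map (fun x => (p : ℚ_[p]) * x) = (p : ℝ≥0∞) • haar p := by
  have h0 := p_ne_zero (p := p)
  let e : ℚ_[p] ≃ₜ ℚ_[p] := Homeomorph.mulLeft₀ (p : ℚ_[p]) h0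
  have hH : ((haar p).map (AddMonoidHom.mulLeft (p : ℚ_[p]))).IsAddHaarMeasure :=
    Measure.isAddHaarMeasure_map (haar p) _ e.continuous e.surjective
      e.isClosedEmbedding.tendsto_cocompact
  have hH' : ((haar p).map (fun x => (p : ℚ_[p]) * x)).IsAddHaarMeasure := hH
  have hmeas : Measurable fun x : ℚ_[p] => (p : ℚ_[p]) * x := e.continuous.measurable
  -- By uniqueness of Haar measure only one scalar is unknown; the preimage of the unit disc, a
  -- disjoint union of `p` translates of it, determines it.
  obtain ⟨c, hc⟩ : ∃ c : ℝ≥0∞, (haar p).map (fun x => (p : ℚ_[p]) * x) = c • haar p :=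
    ⟨_, Measure.addHaarMeasure_unique _ (unitDisc p)⟩
  have hball : MeasurableSet (Metric.closedBall (0 : ℚ_[p]) 1) := Metric.isClosed_closedBall.measurableSet
  have hset : (fun x => (p : ℚ_[p]) * x) ⁻¹' Metric.closedBall 0 1 =
      ⋃ k : Fin (p ^ (0 + 1)), (fun x => x - (node (0 + 1) k : ℚ_[p])) ⁻¹' Metric.closedBall 0 1 := by
    ext x
    have := indicator_p_mul (p := p) 1 x
    simp only [Set.mem_preimage, Set.mem_iUnion]
    constructor
    · intro h
      by_contra! hcon
      rw [Set.indicator_of_mem h, Finset.sum_eq_zero] at this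
      · simp at this
      · exact fun k _ => Set.indicator_of_notMem (hcon k) _
    · rintro ⟨k, hk⟩
      have e : (p : ℚ_[p]) * x = p * (x - node (0 + 1) k) + p * node (0 + 1) k := by ring
      rw [mem_closedBall_zero_iff, e]
      refine (IsUltrametricDist.norm_add_le_max _ _).trans (max_le ?_ (norm_p_mul_node_le k))
      rw [norm_mul]
      exact mul_le_one₀ (Padic.norm_p_lt_one.le) (norm_nonneg _) (by simpa using hk)
  have hc' : c = p := by
    have h2 := congrArg (fun μ : Measure ℚ_[p] => μ (Metric.closedBall 0 1)) hc
    simp only [Measure.smul_apply, haar_closedBall_zero_one, smul_eq_mul, mul_one] at h2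
    rw [← h2, Measure.map_apply hmeas hball, hset, measure_iUnion]
    · have : ∀ k : Fin (p ^ (0 + 1)), haar p ((fun x => x - (node (0 + 1) k : ℚ_[p])) ⁻¹'
          Metric.closedBall 0 1) = 1 := fun k => by
        rw [(measurePreserving_sub_right (haar p) _).measure_preimage hball.nullMeasurableSet,
          haar_closedBall_zero_one]
      simp [this]
    · intro k l hkl
      refine Set.disjoint_left.2 fun x hx hy => hkl (node_injective _ ?_)
      apply shiftSet_eq_of_norm_sub_le
      have e : (node (0 + 1) k : ℚ_[p]) - node (0 + 1) l
          = (x - node (0 + 1) l) - (x - node (0 + 1) k) := by ring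
      rw [e]
      exact (norm_sub_le_max' _ _).trans
        (max_le (by simpa using hy) (by simpa using hx))
    · exact fun k => (measurePreserving_sub_right (haar p) _).measurable hball
  rw [hc, hc']

theorem measurableEmbedding_p_mul : MeasurableEmbedding fun x : ℚ_[p] => (p : ℚ_[p]) * x :=
  (Homeomorph.mulLeft₀ (p : ℚ_[p]) p_ne_zero).measurableEmbedding

theorem quasiMeasurePreserving_p_mul :
    Measure.QuasiMeasurePreserving (fun x : ℚ_[p] => (p : ℚ_[p]) * x) (haar p) (haar p) :=
  ⟨measurableEmbedding_p_mul.measurable, by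
    rw [map_p_mul_haar]; exact Measure.smul_absolutelyContinuous⟩

theorem map_p_inv_mul_haar :
    (haar p).map (fun x => (p : ℚ_[p])⁻¹ * x) = (p : ℝ≥0∞)⁻¹ • haar p := by
  have h0 := p_ne_zero (p := p)
  have hm : Measurable fun x : ℚ_[p] => (p : ℚ_[p])⁻¹ * x :=
    (continuous_const_mul _).measurable
  have h1 := congrArg (Measure.map fun x : ℚ_[p] => (p : ℚ_[p])⁻¹ * x) (map_p_mul_haar (p := p))
  rw [Measure.map_map hm measurableEmbedding_p_mul.measurable, Measure.map_smul] at h1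
  have h2 : (fun x : ℚ_[p] => (p : ℚ_[p])⁻¹ * x) ∘ (fun x => (p : ℚ_[p]) * x) = id := by
    ext x; simp [h0]
  rw [h2, Measure.map_id] at h1
  conv_rhs => rw [h1]
  rw [smul_smul, ENNReal.inv_mul_cancel (by exact_mod_cast (Fact.out : p.Prime).ne_zero) (by simp),
    one_smul]

theorem quasiMeasurePreserving_p_inv_mul :
    Measure.QuasiMeasurePreserving (fun x : ℚ_[p] => (p : ℚ_[p])⁻¹ * x) (haar p) (haar p) :=
  ⟨(continuous_const_mul _).measurable, by
    rw [map_p_inv_mul_haar]; exact Measure.smul_absolutelyContinuous⟩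

theorem setIntegral_p_mul {E : Type*} [NormedAddCommGroup E] [NormedSpace ℝ E] (s : Set ℚ_[p])
    (g : ℚ_[p] → E) :
    ∫ x in (fun x => (p : ℚ_[p]) * x) ⁻¹' s, g (p * x) ∂haar p
      = (p : ℝ) • ∫ x in s, g x ∂haar p := by
  rw [← measurableEmbedding_p_mul.setIntegral_map, map_p_mul_haar, Measure.restrict_smul,
    integral_smul_measure]
  simp

theorem preimage_p_mul_closedBall (y : ℚ_[p]) (n : ℕ) :
    (fun x => (p : ℚ_[p]) * x) ⁻¹' Metric.closedBall y ((p : ℝ)⁻¹ ^ (n + 1))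
      = Metric.closedBall ((p : ℚ_[p])⁻¹ * y) ((p : ℝ)⁻¹ ^ n) := by
  ext x
  have hp := p_real_pos (p := p)
  have e : (p : ℚ_[p]) * x - y = p * (x - (p : ℚ_[p])⁻¹ * y) := by
    rw [mul_sub, mul_inv_cancel_left₀ p_ne_zero]
  rw [Set.mem_preimage, Metric.mem_closedBall, Metric.mem_closedBall, dist_eq_norm, dist_eq_norm, e,
    norm_mul, Padic.norm_p, pow_succ', mul_le_mul_iff_right₀ (by positivity)]

theorem setIntegral_closedBall_sub (g : ℚ_[p] → ℂ) (a z : ℚ_[p]) (r : ℝ) :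
    ∫ x in Metric.closedBall z r, g (x - a) ∂haar p
      = ∫ x in Metric.closedBall (z - a) r, g x ∂haar p := by
  have hs : Metric.closedBall z r = (fun x => x - a) ⁻¹' Metric.closedBall (z - a) r := by
    ext x
    simp [dist_eq_norm]
  rw [hs, (measurePreserving_sub_right (haar p) a).setIntegral_preimage_emb
    (Homeomorph.subRight a).measurableEmbedding]

/-! ### Vanishing of solutions with zero integral -/

theorem isTopologicalBasis_closedBall_inv_pow : TopologicalSpace.IsTopologicalBasis
    (Set.range fun q : ℚ_[p] × ℕ => Metric.closedBall q.1 ((p : ℝ)⁻¹ ^ q.2)) := by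
  have hp := p_real_pos (p := p)
  refine TopologicalSpace.isTopologicalBasis_of_isOpen_of_nhds ?_ ?_
  · rintro _ ⟨q, rfl⟩
    exact IsUltrametricDist.isOpen_closedBall _ (by positivity)
  · intro a u ha hu
    obtain ⟨ε, hε, hsub⟩ := Metric.isOpen_iff.1 hu a ha
    obtain ⟨n, hn⟩ := exists_pow_lt_of_lt_one hε
      (inv_lt_one_of_one_lt₀ (by exact_mod_cast (Fact.out : p.Prime).one_lt) : (p : ℝ)⁻¹ < 1)
    exact ⟨_, ⟨(a, n), rfl⟩, Metric.mem_closedBall_self (by positivity),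
      (Metric.closedBall_subset_ball hn).trans hsub⟩

/-- An integrable function on `ℚ_p` whose total integral and whose integrals over all small balls
vanish is zero almost everywhere. -/
theorem ae_eq_zero_of_setIntegral_closedBall_eq_zero {ψ : ℚ_[p] → ℂ} (hint : Integrable ψ (haar p))
    (h0 : ∫ x, ψ x ∂haar p = 0)
    (hball : ∀ (n : ℕ) (y : ℚ_[p]), ∫ x in Metric.closedBall y ((p : ℝ)⁻¹ ^ n), ψ x ∂haar p = 0) :
    ψ =ᵐ[haar p] 0 := by
  refine hint.ae_eq_zero_of_forall_setIntegral_eq_zero fun s hs _ => ?_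
  -- Finiteness of the measure of `s` must not become a premise of the induction: complements do not
  -- inherit it.
  clear * - hint h0 hball hs
  have hgen := (BorelSpace.measurable_eq (α := ℚ_[p])).trans
    (isTopologicalBasis_closedBall_inv_pow (p := p)).borel_eq_generateFrom
  induction s, hs using MeasurableSpace.induction_on_inter hgen with
  | h_inter =>
    rintro _ ⟨⟨y, n⟩, rfl⟩ _ ⟨⟨z, m⟩, rfl⟩ hne
    rcases IsUltrametricDist.closedBall_subset_trichotomy (x := y) (y := z)
      (r := (p : ℝ)⁻¹ ^ n) (s := (p : ℝ)⁻¹ ^ m) with h | h | h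
    · exact ⟨(y, n), (Set.inter_eq_left.2 h).symm⟩
    · exact ⟨(z, m), (Set.inter_eq_right.2 h).symm⟩
    · exact absurd hne (Set.not_nonempty_iff_eq_empty.2 (Set.disjoint_iff_inter_eq_empty.1 h))
  | empty => simp
  | basic t ht =>
    obtain ⟨q, rfl⟩ := ht
    exact hball _ _
  | compl t ht ih =>
    rw [setIntegral_compl ht hint, h0, ih, sub_zero]
  | iUnion f hd hf ih =>
    rw [integral_iUnion hf hd hint.integrableOn]
    simp [ih]

/-- The substitution `x ↦ p x` and the equation express `p` times the integral over a ball of radius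
`p^-(n+1)` as a combination of integrals over balls of radius `p^-n`. Vanishing thus descends from
radius `1`, where a ball either is the unit disc or misses it. -/
theorem ae_eq_zero_of_refinement {ψ : ℚ_[p] → ℂ} (h : Fin (p ^ (0 + 1)) → ℂ)
    (hint : Integrable ψ (haar p))
    (hsupp : ∀ᵐ x ∂haar p, x ∉ Metric.closedBall (0 : ℚ_[p]) 1 → ψ x = 0)
    (href : ∀ᵐ x ∂haar p, ψ (p * x) = ∑ k, h k * ψ (x - node (0 + 1) k))
    (h0 : ∫ x, ψ x ∂haar p = 0) : ψ =ᵐ[haar p] 0 := by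
  refine ae_eq_zero_of_setIntegral_closedBall_eq_zero hint h0 fun n => ?_
  induction n with
  | zero =>
    intro y
    rw [pow_zero]
    rcases IsUltrametricDist.closedBall_eq_or_disjoint y 0 (1 : ℝ) with hb | hb
    · rw [hb, ← h0]
      exact setIntegral_eq_integral_of_ae_compl_eq_zero hsupp
    · refine setIntegral_eq_zero_of_ae_eq_zero ?_
      filter_upwards [hsupp] with x hx hxy
      exact hx (Set.disjoint_left.1 hb hxy)
  | succ n ih =>
    intro y
    have hp : (p : ℝ) ≠ 0 := p_real_pos.ne'
    have h1 := setIntegral_p_mul (Metric.closedBall y ((p : ℝ)⁻¹ ^ (n + 1))) ψ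
    rw [preimage_p_mul_closedBall, integral_congr_ae (ae_restrict_of_ae href),
      integral_finsetSum] at h1
    · simp_rw [integral_const_mul, setIntegral_closedBall_sub, ih] at h1
      exact (smul_eq_zero.1 (h1.symm.trans (by simp))).resolve_left hp
    · exact fun k _ => ((hint.comp_sub_right _).const_mul _).integrableOn

/-! ### The refinement equation in `L_2` -/

theorem coeFn_translate (a : ℚ_[p]) (φ : L2 p) :
    translate a φ =ᵐ[haar p] fun x => φ (x - a) :=
  Lp.coeFn_compMeasurePreserving φ (measurePreserving_sub_right (haar p) a)

theorem memLp_comp_p_mul (φ : L2 p) : MemLp (fun x => φ ((p : ℚ_[p]) * x)) 2 (haar p) := by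
  refine MemLp.comp_of_map (f := fun x => (p : ℚ_[p]) * x) ?_
    measurableEmbedding_p_mul.measurable.aemeasurable
  rw [map_p_mul_haar]
  exact (Lp.memLp φ).smul_measure (by simp)

/-- The dilate `φ(p ·)` of `φ ∈ L_2(ℚ_p)`. -/
def dilate (φ : L2 p) : L2 p := (memLp_comp_p_mul φ).toLp _

theorem coeFn_dilate (φ : L2 p) : dilate φ =ᵐ[haar p] fun x => φ (p * x) :=
  (memLp_comp_p_mul φ).coeFn_toLp

theorem inner_dilate_self (φ : L2 p) : inner ℂ (dilate φ) (dilate φ) = (p : ℝ) • inner ℂ φ φ := by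
  rw [L2.inner_def, L2.inner_def]
  have h := setIntegral_p_mul (p := p) Set.univ fun x => inner ℂ (φ x) (φ x)
  rw [Set.preimage_univ, setIntegral_univ, setIntegral_univ] at h
  rw [← h]
  refine integral_congr_ae ?_
  filter_upwards [coeFn_dilate φ] with x hx
  rw [hx]

theorem SupportedIn.eq_zero {φ : L2 p} (hφ : SupportedIn 0 φ) :
    ∀ᵐ x ∂haar p, ¬ ‖x‖ ≤ 1 → φ x = 0 := by
  filter_upwards [hφ] with x hx
  simpa using hx

theorem SupportedIn.sub_eq_zero {φ : L2 p} (hφ : SupportedIn 0 φ) (a : ℚ_[p]) :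
    ∀ᵐ x ∂haar p, ¬ ‖x - a‖ ≤ 1 → φ (x - a) = 0 := by
  have hq := (measurePreserving_sub_right (haar p) a).quasiMeasurePreserving
  exact hq.ae (p := fun y => ¬ ‖y‖ ≤ 1 → φ y = 0) hφ.eq_zero

theorem SupportedIn.integrable {φ : L2 p} (hφ : SupportedIn 0 φ) : Integrable φ (haar p) := by
  have hfin : IsFiniteMeasure ((haar p).restrict (Metric.closedBall 0 1)) :=
    ⟨by rw [Measure.restrict_apply_univ, haar_closedBall_zero_one]; exact ENNReal.one_lt_top⟩
  have h1 : IntegrableOn φ (Metric.closedBall 0 1) (haar p) :=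
    ((Lp.memLp φ).restrict _).integrable (by norm_num)
  refine h1.integrable_of_ae_notMem_eq_zero ?_
  filter_upwards [hφ.eq_zero] with x hx hmem
  exact hx (by simpa using hmem)

/-- The supports are a.e. disjoint: `dilate φ` lives on the discs about the `k/p`, and the disc
about `a` is none of these. -/
theorem inner_translate_dilate_eq_zero {φ : L2 p} (hφ : SupportedIn 0 φ) {a : shiftSet p}
    (ha : a ∉ Set.range (node (p := p) (0 + 1))) :
    inner ℂ (translate (a : ℚ_[p]) φ) (dilate φ) = 0 := by
  rw [L2.inner_def]
  refine integral_eq_zero_of_ae ?_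
  filter_upwards [coeFn_translate (a : ℚ_[p]) φ, coeFn_dilate φ, hφ.sub_eq_zero a,
    quasiMeasurePreserving_p_mul.ae hφ.eq_zero] with x h1 h2 h3 h4
  rw [h1, h2]
  by_cases hx : ‖(p : ℚ_[p]) * x‖ ≤ 1
  · obtain ⟨k, hk⟩ := exists_node_norm_sub_le (M := 0 + 1) (x := x) (by simpa using hx)
    rw [h3, inner_zero_left, Pi.zero_apply]
    refine fun hxa => ha ⟨k, shiftSet_eq_of_norm_sub_le ?_⟩
    have e : (node (0 + 1) k : ℚ_[p]) - a = (x - a) - (x - node (0 + 1) k) := by ring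
    rw [e]
    exact (norm_sub_le_max' _ _).trans (max_le hxa hk)
  · rw [h4 hx, inner_zero_right, Pi.zero_apply]

/-- A scaling function supported in the unit disc satisfies a refinement equation. -/
theorem exists_dilate_eq_sum {V : ℤ → Submodule ℂ (L2 p)} (hV : IsMRA V) {φ : L2 p}
    (hs : IsScalingFunction V φ) (hφ : SupportedIn 0 φ) :
    ∃ h : Fin (p ^ (0 + 1)) → ℂ,
      dilate φ = ∑ k, h k • translate (node (0 + 1) k : ℚ_[p]) φ := by
  have hmem : dilate φ ∈ V 0 := by
    -- The dilation axiom is read backwards: `φ`, in `V 0 ≤ V 1`, is the `p⁻¹`-dilate of `dilate φ`.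
    refine (hV.dilation 0 (dilate φ) φ ?_).2 (hV.mono 0 hs.mem)
    filter_upwards [quasiMeasurePreserving_p_inv_mul.ae (coeFn_dilate φ)] with x hx
    rw [hx, mul_inv_cancel_left₀ p_ne_zero]
  have horth := hs.orthonormal.comp _ (node_injective (p := p) (0 + 1))
  refine ⟨fun k => inner ℂ (translate (node (0 + 1) k : ℚ_[p]) φ) (dilate φ), ?_⟩
  set s := ∑ k : Fin (p ^ (0 + 1)), inner ℂ (translate (node (0 + 1) k : ℚ_[p]) φ) (dilate φ) •
    translate (node (0 + 1) k : ℚ_[p]) φ with hsdef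
  have hsub : dilate φ - s ∈ V 0 := by
    rw [← hs.closure_span] at hmem ⊢
    refine sub_mem hmem (Submodule.le_topologicalClosure _ (Submodule.sum_mem _ fun k _ =>
      Submodule.smul_mem _ _ (Submodule.subset_span ⟨node (p := p) (0 + 1) k, rfl⟩)))
  have hperp : dilate φ - s ∈
      (Submodule.span ℂ (Set.range fun a : shiftSet p => translate (a : ℚ_[p]) φ))ᗮ := by
    rw [Submodule.mem_orthogonal]
    intro u hu
    induction hu using Submodule.span_induction with
    | zero => simp
    | add x y _ _ hx hy => rw [inner_add_left, hx, hy, add_zero]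
    | smul c x _ hx => rw [inner_smul_left, hx, mul_zero]
    | mem x hx =>
      obtain ⟨a, rfl⟩ := hx
      rw [inner_sub_right]
      by_cases ha : a ∈ Set.range (node (p := p) (0 + 1))
      · obtain ⟨k, rfl⟩ := ha
        rw [hsdef, sub_eq_zero]
        exact (horth.inner_right_fintype
          (fun k => inner ℂ (translate (node (0 + 1) k : ℚ_[p]) φ) (dilate φ)) k).symm
      · rw [inner_translate_dilate_eq_zero hφ ha, zero_sub, neg_eq_zero, hsdef, inner_sum]
        refine Finset.sum_eq_zero fun k _ => ?_
        rw [inner_smul_right, hs.orthonormal.2 (i := a) (j := node (0 + 1) k)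
          (fun h => ha ⟨k, h.symm⟩), mul_zero]
  rw [← Submodule.orthogonal_closure] at hperp
  rw [← hs.closure_span] at hsub
  exact sub_eq_zero.1 (inner_self_eq_zero.1 (Submodule.inner_right_of_mem_orthogonal hsub hperp))

theorem dilate_eq_sum_iff {φ : L2 p} {h : Fin (p ^ (0 + 1)) → ℂ} :
    dilate φ = ∑ k, h k • translate (node (0 + 1) k : ℚ_[p]) φ ↔
      ∀ᵐ x ∂haar p, φ (p * x) = ∑ k, h k * φ (x - node (0 + 1) k) := by
  have hsum : (∑ k, h k • translate (node (0 + 1) k : ℚ_[p]) φ : L2 p) =ᵐ[haar p]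
      fun x => ∑ k, h k * φ (x - node (0 + 1) k) := by
    have h1 : ∀ᵐ x ∂haar p, ∀ k : Fin (p ^ (0 + 1)),
        (h k • translate (node (0 + 1) k : ℚ_[p]) φ : L2 p) x = h k * φ (x - node (0 + 1) k) := by
      refine ae_all_iff.2 fun k => ?_
      filter_upwards [Lp.coeFn_smul (h k) (translate (node (0 + 1) k : ℚ_[p]) φ),
        coeFn_translate (node (0 + 1) k : ℚ_[p]) φ] with x h1 h2
      rw [h1, Pi.smul_apply, h2, smul_eq_mul]
    filter_upwards [Lp.coeFn_finsetSum Finset.univ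
      fun k => h k • translate (node (0 + 1) k : ℚ_[p]) φ, h1] with x h2 h3
    rw [h2, Finset.sum_apply]
    exact Finset.sum_congr rfl fun k _ => h3 k
  constructor
  · intro heq
    rw [← heq] at hsum
    exact (coeFn_dilate φ).symm.trans hsum
  · intro hae
    exact Lp.ext ((coeFn_dilate φ).trans (Filter.EventuallyEq.trans hae hsum.symm))

theorem ae_refinement_iff {φ : L2 p} {h : Fin (p ^ (0 + 1)) → ℂ} :
    (∀ᵐ x ∂haar p, φ (p * x) = ∑ k, h k * φ (x - node (0 + 1) k)) ↔
      (φ : ℚ_[p] → ℂ) =ᵐ[haar p] fun x => ∑ k, h k * φ (x / (p : ℚ_[p]) - node (0 + 1) k) := by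
  constructor
  · intro H
    filter_upwards [quasiMeasurePreserving_p_inv_mul.ae H] with x hx
    rwa [mul_inv_cancel_left₀ p_ne_zero, inv_mul_eq_div] at hx
  · intro H
    filter_upwards [quasiMeasurePreserving_p_mul.ae H] with x hx
    rwa [mul_div_cancel_left₀ x p_ne_zero] at hx

theorem translate_zero (φ : L2 p) : translate 0 φ = φ := by
  refine Lp.ext ?_
  filter_upwards [coeFn_translate 0 φ] with x hx
  rw [hx, sub_zero]

theorem zero_mem_shiftSet : (0 : ℚ_[p]) ∈ shiftSet p := ⟨0, Fin.elim0, by simp⟩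

theorem IsScalingFunction.norm_eq_one {V : ℤ → Submodule ℂ (L2 p)} {φ : L2 p}
    (hs : IsScalingFunction V φ) : ‖φ‖ = 1 := by
  have h := hs.orthonormal.1 ⟨0, zero_mem_shiftSet⟩
  simpa only [translate_zero] using h

/-! ### Determination of the mask -/

theorem sum_norm_sq_mask {V : ℤ → Submodule ℂ (L2 p)} {φ : L2 p} (hs : IsScalingFunction V φ)
    {h : Fin (p ^ (0 + 1)) → ℂ}
    (hd : dilate φ = ∑ k, h k • translate (node (0 + 1) k : ℚ_[p]) φ) :
    ∑ k, ‖h k‖ ^ 2 = p := by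
  have horth := hs.orthonormal.comp _ (node_injective (p := p) (0 + 1))
  have h1 := inner_dilate_self φ
  rw [inner_self_eq_norm_sq_to_K (𝕜 := ℂ) φ, hs.norm_eq_one, hd] at h1
  have h2 := horth.inner_sum h h Finset.univ
  simp only [Function.comp_apply] at h2
  rw [h2] at h1
  have h3 : ((∑ k, ‖h k‖ ^ 2 : ℝ) : ℂ) = (p : ℝ) := by
    simp only [Complex.conj_mul'] at h1
    push_cast
    rw [h1]
    simp
  exact_mod_cast h3

/-- Equality case of Cauchy–Schwarz against the all-ones vector of length `p`. -/
theorem mask_eq_one {V : ℤ → Submodule ℂ (L2 p)} {φ : L2 p} (hs : IsScalingFunction V φ)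
    {h : Fin (p ^ (0 + 1)) → ℂ}
    (hd : dilate φ = ∑ k, h k • translate (node (0 + 1) k : ℚ_[p]) φ) (hsum : ∑ k, h k = p)
    (k : Fin (p ^ (0 + 1))) : h k = 1 := by
  have h1 := sum_norm_sq_mask hs hd
  have h2 : ∑ k, (h k).re = p := by
    have := congrArg Complex.re hsum
    simpa using this
  have h3 : ∀ k, ‖h k - 1‖ ^ 2 = ‖h k‖ ^ 2 - 2 * (h k).re + 1 := fun k => by
    rw [Complex.sq_norm, Complex.sq_norm, Complex.normSq_apply, Complex.normSq_apply]
    simp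
    ring
  have h4 : ∑ k, ‖h k - 1‖ ^ 2 = 0 := by
    simp_rw [h3, Finset.sum_add_distrib, Finset.sum_sub_distrib, ← Finset.mul_sum, h1, h2]
    simp
    ring
  have h5 := (Finset.sum_eq_zero_iff_of_nonneg fun k _ => by positivity).1 h4 k (Finset.mem_univ k)
  simpa [sub_eq_zero] using h5

/-- Integrating the equation gives `(∑ h) ∫ φ = p ∫ φ`; the integral cancels because a zero integral
would force `φ = 0`. -/
theorem sum_mask {φ : L2 p} (hφ : SupportedIn 0 φ) (hne : φ ≠ 0) {h : Fin (p ^ (0 + 1)) → ℂ}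
    (hr : ∀ᵐ x ∂haar p, φ (p * x) = ∑ k, h k * φ (x - node (0 + 1) k)) : ∑ k, h k = p := by
  have hint := hφ.integrable
  have hc : ∫ x, φ x ∂haar p ≠ 0 := by
    intro h0
    exact hne ((Lp.eq_zero_iff_ae_eq_zero).2 (ae_eq_zero_of_refinement h hint
      (by simpa [SupportedIn] using hφ) hr h0))
  have h1 := setIntegral_p_mul (p := p) Set.univ φ
  rw [Set.preimage_univ, setIntegral_univ, setIntegral_univ, integral_congr_ae hr,
    integral_finsetSum _ fun k _ => (hint.comp_sub_right _).const_mul _] at h1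
  simp_rw [integral_const_mul, integral_sub_right_eq_self (fun x => φ x), ← Finset.sum_mul] at h1
  refine mul_right_cancel₀ hc (h1.trans ?_)
  simp

/-! ### Shape of the scaling function and its accuracy -/

/-- A scaling function supported in the unit disc is a nonzero multiple of its indicator. -/
theorem ae_eq_indicator {V : ℤ → Submodule ℂ (L2 p)} {φ : L2 p} (hs : IsScalingFunction V φ)
    (hφ : SupportedIn 0 φ)
    (hr : ∀ᵐ x ∂haar p, φ (p * x) = ∑ k : Fin (p ^ (0 + 1)), 1 * φ (x - node (0 + 1) k)) :
    ∃ c : ℂ, c ≠ 0 ∧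
      φ =ᵐ[haar p] (Metric.closedBall (0 : ℚ_[p]) 1).indicator fun _ => c := by
  set B := Metric.closedBall (0 : ℚ_[p]) 1
  have hB : MeasurableSet B := Metric.isClosed_closedBall.measurableSet
  set c := ∫ x, φ x ∂haar p
  have hfin : haar p B ≠ ∞ := by rw [haar_closedBall_zero_one]; exact ENNReal.one_ne_top
  have hI : Integrable (B.indicator fun _ => c) (haar p) :=
    (integrable_indicator_iff hB).2 (integrableOn_const hfin)
  -- The indicator also solves the equation with mask `1`, and the disc has measure `1`, so
  -- subtracting `c = ∫ φ` times it leaves a solution with zero integral.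
  have key : (fun x => φ x - B.indicator (fun _ => c) x) =ᵐ[haar p] 0 := by
    refine ae_eq_zero_of_refinement (fun _ => 1) (hφ.integrable.sub hI) ?_ ?_ ?_
    · filter_upwards [hφ] with x hx hxB
      rw [hx (by simpa using hxB), Set.indicator_of_notMem hxB, sub_zero]
    · filter_upwards [hr] with x hx
      rw [hx, indicator_p_mul, ← Finset.sum_sub_distrib]
      simp [B]
    · rw [integral_sub hφ.integrable hI, integral_indicator hB, setIntegral_const, measureReal_def,
        haar_closedBall_zero_one]
      simp [c]
  have heq : φ =ᵐ[haar p] B.indicator fun _ => c := by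
    filter_upwards [key] with x hx
    exact sub_eq_zero.1 hx
  refine ⟨c, fun hc => ?_, heq⟩
  have h0 : φ = 0 := Lp.eq_zero_iff_ae_eq_zero.2 (heq.trans (by simp [hc]; rfl))
  have := hs.norm_eq_one
  simp [h0] at this

/-- For a multiple of the indicator of the unit disc, the semi-convolution is a step function. -/
theorem ae_semiconv_eq {φ : L2 p} {c : ℂ}
    (hφ : φ =ᵐ[haar p] (Metric.closedBall (0 : ℚ_[p]) 1).indicator fun _ => c)
    (b : shiftSet p → ℂ) :
    ∀ᵐ x ∂haar p, ∀ a : shiftSet p, ‖x - (a : ℚ_[p])‖ ≤ 1 → semiconv φ b x = c * b a := by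
  have hall : ∀ᵐ x ∂haar p, ∀ a : shiftSet p,
      φ (x - a) = (Metric.closedBall (0 : ℚ_[p]) 1).indicator (fun _ => c) (x - a) := by
    refine ae_all_iff.2 fun a => ?_
    have hq := (measurePreserving_sub_right (haar p) (a : ℚ_[p])).quasiMeasurePreserving
    exact hq.ae (p := fun y => φ y = (Metric.closedBall (0 : ℚ_[p]) 1).indicator (fun _ => c) y) hφ
  filter_upwards [hall] with x hx a ha
  rw [semiconv, tsum_eq_single a]
  · rw [hx, Set.indicator_of_mem (by simpa using ha)]
  · intro d hd
    rw [hx, Set.indicator_of_notMem, zero_mul]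
    refine fun hmem => hd (shiftSet_eq_of_norm_sub_le ?_)
    have e : (d : ℚ_[p]) - a = (x - a) - (x - d) := by ring
    rw [e]
    exact (norm_sub_le_max' _ _).trans (max_le ha (by simpa using hmem))

/-- For `k ≥ 2`, `X` would have to be a.e. constant on the unit disc; `ι` is injective and points
are null, so this fails. For `k ≤ 1` only constants occur. -/
theorem hasAccuracy_iff {φ : L2 p} {c : ℂ} (hc : c ≠ 0)
    (hφ : φ =ᵐ[haar p] (Metric.closedBall (0 : ℚ_[p]) 1).indicator fun _ => c)
    (ι : ℚ_[p] →+* ℂ) (k : ℕ) : HasAccuracy ι φ k ↔ k ≤ 1 := by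
  constructor
  · intro hacc
    by_contra! hk
    obtain ⟨b, hb⟩ := hacc (Submodule.subset_span ⟨Polynomial.X, by
      rw [Polynomial.degree_X]; exact_mod_cast hk, rfl⟩)
    have hconst : ∀ᵐ x ∂haar p, ‖x‖ ≤ 1 → ι x = c * b ⟨0, zero_mem_shiftSet⟩ := by
      filter_upwards [hb, ae_semiconv_eq hφ b] with x h1 h2 hx
      rw [← h2 ⟨0, zero_mem_shiftSet⟩ (by simpa using hx), ← h1, Polynomial.eval_X]
    have hsub : {x : ℚ_[p] | ι x = c * b ⟨0, zero_mem_shiftSet⟩}.Subsingleton :=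
      fun x hx y hy => ι.injective (hx.trans hy.symm)
    have hnull : haar p {x : ℚ_[p] | ι x = c * b ⟨0, zero_mem_shiftSet⟩} = 0 :=
      hsub.measure_zero _
    have h1 : haar p (Metric.closedBall 0 1) = 0 := by
      refine measure_mono_null (t := {x | ¬ (‖x‖ ≤ 1 → ι x = c * b ⟨0, zero_mem_shiftSet⟩)} ∪
        {x : ℚ_[p] | ι x = c * b ⟨0, zero_mem_shiftSet⟩}) ?_ (measure_union_null hconst hnull)
      intro x hx
      by_cases h : ι x = c * b ⟨0, zero_mem_shiftSet⟩
      · exact Or.inr h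
      · exact Or.inl fun hcon => h (hcon (by simpa using hx))
    rw [haar_closedBall_zero_one] at h1
    exact one_ne_zero h1
  · intro hk f hf
    have hconst : ∃ z : ℂ, f = fun _ => z := by
      induction hf using Submodule.span_induction with
      | mem x hx =>
        obtain ⟨r, hr, rfl⟩ := hx
        have hr0 : r.degree ≤ 0 := by
          have : r.degree < 1 := hr.trans_le (by exact_mod_cast hk)
          exact Nat.WithBot.lt_one_iff_le_zero.1 this
        refine ⟨ι (r.coeff 0), ?_⟩
        rw [Polynomial.eq_C_of_degree_le_zero hr0]
        simp
      | zero => exact ⟨0, rfl⟩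
      | add f g _ _ hf hg =>
        obtain ⟨z, rfl⟩ := hf
        obtain ⟨w, rfl⟩ := hg
        exact ⟨z + w, rfl⟩
      | smul d f _ hf =>
        obtain ⟨z, rfl⟩ := hf
        exact ⟨d * z, rfl⟩
    obtain ⟨z, rfl⟩ := hconst
    refine ⟨fun _ => c⁻¹ * z, ?_⟩
    filter_upwards [ae_semiconv_eq hφ fun _ => c⁻¹ * z] with x hx
    obtain ⟨a, ha⟩ := exists_shiftSet_norm_sub_le x
    rw [hx a ha, mul_inv_cancel_left₀ hc]

end

end PadicMRA

theorem mainTheorem3 (p : ℕ) [Fact p.Prime] (φ : PadicMRA.L2 p)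
    (hφ : PadicMRA.GeneratesMRA φ) (hsupp : PadicMRA.SupportedIn 0 φ) :
    (∃! h : PadicMRA.shiftSet p → ℂ, PadicMRA.IsRefinementMask 0 φ h) ∧
    (∀ h : PadicMRA.shiftSet p → ℂ, PadicMRA.IsRefinementMask 0 φ h →
      ∀ k : Fin (p ^ (0 + 1)), h (PadicMRA.node (0 + 1) k) = 1) ∧
    (∀ (ι : ℚ_[p] →+* ℂ) (k : ℕ), PadicMRA.HasAccuracy ι φ k ↔ k ≤ 1) := by
  classical
  obtain ⟨V, hV, hs⟩ := hφ
  have hone : ∀ h : PadicMRA.shiftSet p → ℂ, PadicMRA.IsRefinementMask 0 φ h →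
      ∀ k : Fin (p ^ (0 + 1)), h (PadicMRA.node (0 + 1) k) = 1 := fun h hh k =>
    PadicMRA.mask_eq_one hs (h := fun k => h (PadicMRA.node (0 + 1) k))
      (PadicMRA.dilate_eq_sum_iff.2 (PadicMRA.ae_refinement_iff.2 hh.refinement)) hh.sum_eq k
  obtain ⟨g, hg⟩ := PadicMRA.exists_dilate_eq_sum hV hs hsupp
  have hne : φ ≠ 0 := by
    rintro rfl
    have h := hs.norm_eq_one
    simp at h
  -- For a given mask the sum is part of the definition; for the expansion coefficients `g` it has
  -- to be proved.
  have hsum := PadicMRA.sum_mask hsupp hne (PadicMRA.dilate_eq_sum_iff.1 hg)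
  obtain rfl : g = fun _ => 1 := funext (PadicMRA.mask_eq_one hs hg hsum)
  have hr := PadicMRA.dilate_eq_sum_iff.1 hg
  refine ⟨⟨fun a => if a ∈ Set.range (PadicMRA.node (p := p) (0 + 1)) then 1 else 0,
    ⟨fun a ha => if_neg ha, ?_, ?_⟩, fun h hh => ?_⟩, hone, ?_⟩
  · simp
  · simpa using PadicMRA.ae_refinement_iff.1 hr
  · funext a
    by_cases ha : a ∈ Set.range (PadicMRA.node (p := p) (0 + 1))
    · rw [if_pos ha]
      obtain ⟨k, rfl⟩ := ha
      exact hone h hh k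
    · rw [if_neg ha, hh.eq_zero a ha]
  · intro ι k
    obtain ⟨c, hc, hφc⟩ := PadicMRA.ae_eq_indicator hs hsupp hr
    exact PadicMRA.hasAccuracy_iff hc hφc ι k
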